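/- Let $((A_{t,j})_{j\ge 1},B_t)_{t\in\mathbb Z}$ be independent and identically distributed random sequences with non-negative entries, and write $A_j=A_{1,j}$, $B=B_1$. Assume that for some integer $p$ with $1\le p<\infty$ one has, for all $t\in\mathbb Z$, $A_{t,j}=0$ almost surely for $j>p$ and $A_{t,j}>0$ almost surely for $1\le j\le p$, that $B$ is independent of $(A_1,\dots,A_p)$, and that $\mathbb E[B^2]<\infty$. Let $\mathscr T$ be the set of finite integer sequences $\mathbf t=(t_0,\dots,t_n)$ with $n=n(\mathbf t)\ge 0$ and $0=t_0<t_1<\dots<t_n$. Put $\tilde A_{t,j}=A_{-t,j}$ and $\tilde A_{\mathbf t}=\prod_{i=0}^{n-1}\tilde A_{t_i,\,t_{i+1}-t_i}$ (with $\tilde A_{\mathbf t}=1$ if $n=0$). Let $\mathscr C$ be the set of closed pairs, i.e. of pairs $(\mathbf s,\mathbf t)\in\mathscr T\times\mathscr T$ with $n(\mathbf s)>0$, $n(\mathbf t)>0$, $s_{n(\mathbf s)}=t_{n(\mathbf t)}$, and $s_i\neq t_j$ whenever $0<i<n(\mathbf s)$ and $0<j<n(\mathbf t)$. Let $$\mathbf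 A=\begin{pmatrix}A_1&A_2&\cdots&A_{p-1}&A_p\\1&0&\cdots&0&0\\0&1&\cdots&0&0\\\vdots&&\ddots&&\vdots\\0&0&\cdots&1&0\end{pmatrix}$$ be the $p\times p$ companion matrix (for $p=1$, $\mathbf A=(A_1)$), let $\otimes$ be the Kronecker product, let $\mathbb E[\mathbf A\otimes\mathbf A]$ be the entrywise expectation, and let $\rho$ be the spectral radius, i.e. the largest modulus of a complex eigenvalue. Then $$\sum_{(\mathbf s,\mathbf t)\in\mathscr C}\mathbb E[\tilde A_{\mathbf s}\tilde A_{\mathbf t}]<1\quad\text{and}\quad\sum_{j=1}^\infty\mathbb E[A_j]<1$$ if and only if $$\rho(\mathbb E[\mathbf A\otimes\mathbf A])<1 .$$ The expectations and sums in the first condition take values in $[0,\infty]$; the second condition is understood to include that all entries of $\mathbb E[\mathbf A\otimes\mathbf A]$ are finite. -/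

import Mathlib

open MeasureTheory ProbabilityTheory
open scoped ENNReal Kronecker

/-- A finite strictly increasing integer sequence `0 = t₀ < t₁ < ⋯ < tₙ`, with `n ≥ 0`. -/
structure IncSeq where
  /-- the number `n` of jumps -/
  n : ℕ
  /-- the terms `t₀, …, tₙ` -/
  term : Fin (n + 1) → ℕ
  term_zero : term 0 = 0
  strictMono : StrictMono term

/-- The `i`-th jump `t_{i+1} - t_i ≥ 1`, for `0 ≤ i < n`. -/
def IncSeq.jump (t : IncSeq) (i : Fin t.n) : ℕ+ :=
  ⟨t.term i.succ - t.term i.castSucc, Nat.sub_pos_of_lt (t.strictMono i.castSucc_lt_succ)⟩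

/-- Closed pairs: both sequences are nontrivial, they have the same last term, and no
interior term of one equals an interior term of the other. -/
def closedPairs : Set (IncSeq × IncSeq) :=
  {q | 0 < q.1.n ∧ 0 < q.2.n ∧ q.1.term (Fin.last q.1.n) = q.2.term (Fin.last q.2.n) ∧
    ∀ (i : Fin (q.1.n + 1)) (j : Fin (q.2.n + 1)),
      0 < i → i < Fin.last q.1.n → 0 < j → j < Fin.last q.2.n → q.1.term i ≠ q.2.term j}

section

variable {Ω : Type*}

/-- The time-reversed coefficients `Ã_{t,j} = A_{-t,j}`. -/
def tildeCoeff (A : ℤ → ℕ+ → Ω → ℝ) (t : ℤ) (j : ℕ+) (ω : Ω) : ℝ :=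
  A (-t) j ω

/-- `Ã_𝐭 = Ã_{t₀,t₁-t₀} ⋯ Ã_{t_{n-1},tₙ-t_{n-1}}`, the empty product being `1`. -/
def pathCoeff (A : ℤ → ℕ+ → Ω → ℝ) (t : IncSeq) (ω : Ω) : ℝ :=
  ∏ i : Fin t.n, tildeCoeff A (t.term i.castSucc : ℤ) (t.jump i) ω

/-- The `p × p` companion matrix `𝐀_t`: first row `A_{t,1}, …, A_{t,p}`, ones on the
subdiagonal, zeros elsewhere (rows and columns are numbered from `0` here). -/
def companionMatrix (A : ℤ → ℕ+ → Ω → ℝ) (p : ℕ) (t : ℤ) (ω : Ω) :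
    Matrix (Fin p) (Fin p) ℝ :=
  Matrix.of fun i j =>
    if (i : ℕ) = 0 then A t (Nat.succPNat j) ω
    else if (i : ℕ) = (j : ℕ) + 1 then 1 else 0

/-- The tensor square `𝐀 ⊗ 𝐀` of the companion matrix `𝐀 = 𝐀_1`. -/
def companionSq (A : ℤ → ℕ+ → Ω → ℝ) (p : ℕ) (ω : Ω) :
    Matrix (Fin p × Fin p) (Fin p × Fin p) ℝ :=
  companionMatrix A p 1 ω ⊗ₖ companionMatrix A p 1 ω

/-- The entrywise expectation `E[𝐀 ⊗ 𝐀]`, as a complex matrix; it is meaningful when all the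
entries of `𝐀 ⊗ 𝐀` are integrable. -/
noncomputable def meanCompanionSq [MeasurableSpace Ω] (μ : Measure Ω)
    (A : ℤ → ℕ+ → Ω → ℝ) (p : ℕ) : Matrix (Fin p × Fin p) (Fin p × Fin p) ℂ :=
  Matrix.of fun i j => ((∫ ω, companionSq A p ω i j ∂μ : ℝ) : ℂ)

end

/-!
Follow the two sequences of a pair `(𝐬, 𝐭)` in time and record, at each time, the two residual
waiting times until the next visited points. Since row `0` of the companion matrix makes a jump and
row `i + 1` steps down to `i`, the matrix `M = E[𝐀 ⊗ 𝐀]` is exactly the transition matrix of the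
weights of this pair of waiting times, on the states `(i, j)` with `i, j < p`. Closed pairs are the
excursions from `(0, 0)` to `(0, 0)`, so that the sum of their expectations is
`F = ∑ E[A_{i+1} A_{j+1}] h(i, j)`, where `h` (`hitWeight`) is the total weight of hitting `(0, 0)`
from `(i, j)`. To make this precise, a closed pair is coded as a word in three letters, telling for
each interior time which of the sequences, if any, visits it (`wordEquiv`); independence factors
the expectation into the weight of the word (`lintegral_pathCoeff_traceSeq`), and removing the first
letter gives the recurrence for `h`.

Call `v ≥ 0` subharmonic if `v ≤ M v`. For a nonnegative matrix, spectral radius below `1` excludes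
nonzero subharmonic vectors (`subharmonic_nonpos_of_spectralRadius_lt_one`), and spectral radius at
least `1` produces one from an eigenvector (`exists_subharmonic_of_one_le_spectralRadius`).

If `F < 1` and `∑ E[A_j] < 1`, the chain killed at `(0, 0)` is transient, so a subharmonic `v`
satisfies `v ≤ h v(0, 0)` (`le_hitWeight_mul`), whence `v(0, 0) ≤ F v(0, 0)` and `v = 0`. The
entries of `M` are finite because `h(i, i) = 1` gives `E[A_{i+1}²] ≤ F`.

Conversely, let the spectral radius be below `1`. That `∑ E[A_j] < 1` follows from the comparison of
`Mⁿ(𝟙𝟙ᵀ)` with `(E[𝐀]ⁿ𝟙)(E[𝐀]ⁿ𝟙)ᵀ` as quadratic forms (`sq_le_quadraticForm_mean_kronecker`,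
`tsum_coeffMean_lt_one`). Then `h ≤ 1`, and `F ≥ 1` would make `h` a nonzero subharmonic vector.
-/

open MeasureTheory ProbabilityTheory
open scoped ENNReal Kronecker

/-! ### Words and hitting weights -/

/-- The weight of a word. A letter `some true` (`some false`) at position `k` records a visit of the
first (second) path at time `k + 1`, and `none` no visit. With the end of the word read as a visit
of both paths, a visit by path `b` is followed by a jump of length `(w.idxOf (some b)) + 1`, where
`w` is the rest of the word (`List.idxOf` is the length of the word if the letter does not occur).
`a k` is the weight of a jump of length `k + 1`. -/
noncomputable def wordWeight (a : ℕ → ℝ≥0∞) : List (Option Bool) → ℝ≥0∞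
  | [] => 1
  | none :: w => wordWeight a w
  | some b :: w => a (w.idxOf (some b)) * wordWeight a w

/-- The total weight of the words of length less than `N` (of all words, for `N = ⊤`) in which the
first visits of the two paths are at positions `i` and `j`. In terms of the pair of residual waiting
times, started at `(i, j)`, it is the weight of hitting `(0, 0)` in fewer than `N` steps. -/
noncomputable def hitWeight (a : ℕ → ℝ≥0∞) (N : ℕ∞) (i j : ℕ) : ℝ≥0∞ :=
  ∑' w : List (Option Bool),
    if (w.length : ℕ∞) < N ∧ w.idxOf (some true) = i ∧ w.idxOf (some false) = j
      then wordWeight a w else 0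

theorem tsum_word (f : List (Option Bool) → ℝ≥0∞) :
    ∑' w, f w = f [] + (∑' w, f (none :: w) + ∑' w, f (some true :: w) +
      ∑' w, f (some false :: w)) := by
  let e : Unit ⊕ (Option Bool × List (Option Bool)) ≃ List (Option Bool) :=
    { toFun := Sum.elim (fun _ => []) fun q => q.1 :: q.2
      invFun := fun w => match w with
        | [] => .inl ()
        | x :: w => .inr (x, w)
      left_inv := by rintro (_ | ⟨x, w⟩) <;> rfl
      right_inv := by rintro (_ | ⟨x, w⟩) <;> rfl }
  rw [← e.tsum_eq, Summable.tsum_sum ENNReal.summable ENNReal.summable, ENNReal.tsum_prod',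
    tsum_fintype (f := fun x => ∑' w, f (e (.inr (x, w))))]
  simp only [Fintype.sum_option, Fintype.sum_bool]
  simp [e, add_assoc]

theorem hitWeight_zero_zero (a : ℕ → ℝ≥0∞) (N : ℕ∞) : hitWeight a (N + 1) 0 0 = 1 := by
  rw [hitWeight, tsum_word]
  simp [wordWeight]

theorem length_lt_iff (w : List (Option Bool)) (N : ℕ∞) :
    (w.length : ℕ∞) + 1 < N + 1 ↔ (w.length : ℕ∞) < N :=
  ENat.add_lt_add_iff_right (by simp)

theorem hitWeight_succ_succ (a : ℕ → ℝ≥0∞) (N : ℕ∞) (i j : ℕ) :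
    hitWeight a (N + 1) (i + 1) (j + 1) = hitWeight a N i j := by
  rw [hitWeight, tsum_word]
  simp [wordWeight, hitWeight]

theorem hitWeight_zero_succ (a : ℕ → ℝ≥0∞) (N : ℕ∞) (j : ℕ) :
    hitWeight a (N + 1) 0 (j + 1) = ∑' k, a k * hitWeight a N k j := by
  simp_rw [hitWeight, ← ENNReal.tsum_mul_left]
  rw [tsum_word, ENNReal.tsum_comm]
  simp only [List.idxOf_cons, wordWeight, List.length_cons, Nat.cast_add, Nat.cast_one,
    length_lt_iff]
  simp only [mul_ite, mul_zero]
  simp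
  congr 1; ext w
  by_cases h : (w.length : ℕ∞) < N ∧ w.idxOf (some false) = j
  · rw [if_pos h, tsum_eq_single (w.idxOf (some true))]
    · simp [h]
    · intro k hk; simp [hk.symm]
  · rw [if_neg h]; symm
    simp only [ENNReal.tsum_eq_zero]
    intro k; rw [if_neg (by tauto)]

theorem hitWeight_succ_zero (a : ℕ → ℝ≥0∞) (N : ℕ∞) (i : ℕ) :
    hitWeight a (N + 1) (i + 1) 0 = ∑' k, a k * hitWeight a N i k := by
  simp_rw [hitWeight, ← ENNReal.tsum_mul_left]
  rw [tsum_word, ENNReal.tsum_comm]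
  simp only [List.idxOf_cons, wordWeight, List.length_cons, Nat.cast_add, Nat.cast_one,
    length_lt_iff]
  simp only [mul_ite, mul_zero]
  simp
  congr 1; ext w
  by_cases h : (w.length : ℕ∞) < N ∧ w.idxOf (some true) = i
  · rw [if_pos h, tsum_eq_single (w.idxOf (some false))]
    · simp [h]
    · intro k hk; simp [hk.symm]
  · rw [if_neg h]; symm
    simp only [ENNReal.tsum_eq_zero]
    intro k; rw [if_neg (by tauto)]

theorem tsum_mul_wordWeight (a : ℕ → ℝ≥0∞) (c : ℕ → ℕ → ℝ≥0∞) :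
    ∑' w : List (Option Bool), c (w.idxOf (some true)) (w.idxOf (some false)) * wordWeight a w =
      ∑' i, ∑' j, c i j * hitWeight a ⊤ i j := by
  simp_rw [hitWeight, ← ENNReal.tsum_mul_left]
  rw [← ENNReal.tsum_prod, ENNReal.tsum_comm]
  congr 1; ext w
  rw [tsum_eq_single (w.idxOf (some true), w.idxOf (some false))]
  · simp
  · rintro ⟨i, j⟩ h
    rw [if_neg, mul_zero]
    rintro ⟨-, rfl, rfl⟩
    exact h rfl

theorem hitWeight_diag (a : ℕ → ℝ≥0∞) (i : ℕ) : hitWeight a ⊤ i i = 1 := by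
  induction i with
  | zero => exact hitWeight_zero_zero a ⊤
  | succ i ih => rw [← ih]; exact hitWeight_succ_succ a ⊤ i i

theorem hitWeight_natCast_le_one {a : ℕ → ℝ≥0∞} (ha : ∑' k, a k ≤ 1) (N i j : ℕ) :
    hitWeight a N i j ≤ 1 := by
  have key : ∀ f : ℕ → ℝ≥0∞, (∀ k, f k ≤ 1) → ∑' k, a k * f k ≤ 1 := fun f hf =>
    (ENNReal.tsum_le_tsum fun k => mul_le_of_le_one_right' (hf k)).trans ha
  induction N generalizing i j with
  | zero => simp [hitWeight]
  | succ N ih =>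
    push_cast
    rcases i with _ | i <;> rcases j with _ | j
    · exact (hitWeight_zero_zero a N).le
    · rw [hitWeight_zero_succ]; exact key _ fun k => ih k j
    · rw [hitWeight_succ_zero]; exact key _ fun k => ih i k
    · rw [hitWeight_succ_succ]; exact ih i j

/-- As `∑ a ≤ 1`, away from `(0, 0)` the residual waiting times form a substochastic chain. -/
theorem hitWeight_top_le_one {a : ℕ → ℝ≥0∞} (ha : ∑' k, a k ≤ 1) (i j : ℕ) :
    hitWeight a ⊤ i j ≤ 1 := by
  rw [hitWeight, ENNReal.tsum_eq_iSup_sum]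
  refine iSup_le fun s => ?_
  let N := s.sup List.length + 1
  refine le_trans ?_ (hitWeight_natCast_le_one ha N i j)
  refine le_trans (Finset.sum_le_sum fun w hw => ?_) (ENNReal.sum_le_tsum s)
  have : (w.length : ℕ∞) < N := by
    exact_mod_cast Nat.lt_succ_of_le (Finset.le_sup (f := List.length) hw)
  simp [this]

/-- Maximum principle for the chain killed at `(0, 0)`: a bounded function that is subharmonic off
`(0, 0)` is dominated by its value at `(0, 0)` times the hitting weight. -/
theorem le_hitWeight_mul {a : ℕ → ℝ≥0∞} (ha : ∑' k, a k < 1) {v : ℕ → ℕ → ℝ≥0∞} {C : ℝ≥0∞}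
    (hC : C ≠ ∞) (hv : ∀ i j, v i j ≤ C)
    (h₁ : ∀ i j, v (i + 1) (j + 1) ≤ v i j)
    (h₂ : ∀ j, v 0 (j + 1) ≤ ∑' k, a k * v k j)
    (h₃ : ∀ i, v (i + 1) 0 ≤ ∑' k, a k * v i k) (i j : ℕ) :
    v i j ≤ hitWeight a ⊤ i j * v 0 0 := by
  have e₀ : hitWeight a ⊤ 0 0 = 1 := hitWeight_zero_zero a ⊤
  have e₁ : ∀ i j, hitWeight a ⊤ (i + 1) (j + 1) = hitWeight a ⊤ i j := hitWeight_succ_succ a ⊤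
  have e₂ : ∀ j, hitWeight a ⊤ 0 (j + 1) = ∑' k, a k * hitWeight a ⊤ k j :=
    hitWeight_zero_succ a ⊤
  have e₃ : ∀ i, hitWeight a ⊤ (i + 1) 0 = ∑' k, a k * hitWeight a ⊤ i k :=
    hitWeight_succ_zero a ⊤
  have step : ∀ (u g : ℕ → ℝ≥0∞) (D : ℝ≥0∞), (∀ k, u k ≤ g k * v 0 0 + D) →
      ∑' k, a k * u k ≤ (∑' k, a k * g k) * v 0 0 + (∑' k, a k) * D := by
    intro u g D hu
    rw [← ENNReal.tsum_mul_right, ← ENNReal.tsum_mul_right, ← ENNReal.tsum_add]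
    refine ENNReal.tsum_le_tsum fun k => (mul_le_mul_right (hu k) (a k)).trans ?_
    rw [mul_add, mul_assoc]
  -- The error term gains a factor `∑ a` with each application of the averaging inequalities.
  have iter : ∀ (n i j : ℕ), v i j ≤ hitWeight a ⊤ i j * v 0 0 + (∑' k, a k) ^ n * C := by
    intro n
    induction n with
    | zero => intro i j; simpa using (hv i j).trans le_add_self
    | succ n ih =>
      intro i
      induction i with
      | zero =>
        rintro (_ | j)
        · simp [e₀]
        · rw [e₂, pow_succ', mul_assoc]
          exact (h₂ j).trans (step _ _ _ fun k => ih k j)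
      | succ i ihi =>
        rintro (_ | j)
        · rw [e₃, pow_succ', mul_assoc]
          exact (h₃ i).trans (step _ _ _ fun k => ih i k)
        · rw [e₁]; exact (h₁ i j).trans (ihi j)
  have lim : Filter.Tendsto (fun n : ℕ => hitWeight a ⊤ i j * v 0 0 + (∑' k, a k) ^ n * C)
      Filter.atTop (nhds (hitWeight a ⊤ i j * v 0 0 + 0 * C)) :=
    (ENNReal.Tendsto.mul_const (ENNReal.tendsto_pow_atTop_nhds_zero_of_lt_one ha)
      (Or.inr hC)).const_add _
  simpa using ge_of_tendsto' lim fun n => iter n i j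

/-- The action of `E[𝐀 ⊗ 𝐀]` on functions of the pair of residual waiting times: at time `0` a path
chooses a jump, with weights `a k` for one path alone and `c k l` for both together; a positive
waiting time decreases by one. -/
noncomputable def secondMomentStep (a : ℕ → ℝ≥0∞) (c : ℕ → ℕ → ℝ≥0∞) (f : ℕ → ℕ → ℝ≥0∞) :
    ℕ → ℕ → ℝ≥0∞
  | 0, 0 => ∑' k, ∑' l, c k l * f k l
  | 0, j + 1 => ∑' k, a k * f k j
  | i + 1, 0 => ∑' l, a l * f i l
  | i + 1, j + 1 => f i j

/-- If the weight `∑ c i j * hitWeight a ⊤ i j` of the first return to `(0, 0)` is below `1`, then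
bounded subharmonic functions vanish. -/
theorem eq_zero_of_le_secondMomentStep {a : ℕ → ℝ≥0∞} {c : ℕ → ℕ → ℝ≥0∞} (ha : ∑' k, a k < 1)
    (hF : ∑' i, ∑' j, c i j * hitWeight a ⊤ i j < 1) {v : ℕ → ℕ → ℝ≥0∞} {C : ℝ≥0∞}
    (hC : C ≠ ∞) (hv : ∀ i j, v i j ≤ C) (h : ∀ i j, v i j ≤ secondMomentStep a c v i j)
    (i j : ℕ) : v i j = 0 := by
  have hle := le_hitWeight_mul ha hC hv (fun i j => h (i + 1) (j + 1)) (fun j => h 0 (j + 1))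
    (fun i => h (i + 1) 0)
  have h00 : v 0 0 = 0 := by
    by_contra hne
    have hlt : (∑' i, ∑' j, c i j * hitWeight a ⊤ i j) * v 0 0 < 1 * v 0 0 :=
      (ENNReal.mul_lt_mul_iff_left hne (ne_top_of_le_ne_top hC (hv 0 0))).2 hF
    rw [one_mul] at hlt
    refine absurd ((h 0 0).trans ?_) hlt.not_ge
    simp_rw [← ENNReal.tsum_mul_right, mul_assoc]
    exact ENNReal.tsum_le_tsum fun i => ENNReal.tsum_le_tsum fun j => mul_le_mul_right (hle i j) _
  simpa [h00] using hle i j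

/-- If the return weight is at least `1`, the hitting weight is itself subharmonic. -/
theorem hitWeight_le_secondMomentStep {a : ℕ → ℝ≥0∞} {c : ℕ → ℕ → ℝ≥0∞}
    (hF : 1 ≤ ∑' i, ∑' j, c i j * hitWeight a ⊤ i j) (i j : ℕ) :
    hitWeight a ⊤ i j ≤ secondMomentStep a c (hitWeight a ⊤) i j := by
  rcases i with _ | i <;> rcases j with _ | j
  · exact (hitWeight_zero_zero a ⊤).trans_le hF
  · exact (hitWeight_zero_succ a ⊤ j).le
  · exact (hitWeight_succ_zero a ⊤ i).le
  · exact (hitWeight_succ_succ a ⊤ i j).le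

/-! ### Spectral radius of a nonnegative matrix -/

section

variable {n : Type*} [Fintype n] [DecidableEq n]

/-- The entrywise modulus of an eigenvector for an eigenvalue of modulus at least `1` is
subharmonic. -/
theorem exists_subharmonic_of_one_le_spectralRadius {M : Matrix n n ℝ} (hM : ∀ i j, 0 ≤ M i j)
    (hρ : 1 ≤ spectralRadius ℂ (M.map ((↑) : ℝ → ℂ))) :
    ∃ v : n → ℝ, v ≠ 0 ∧ 0 ≤ v ∧ v ≤ M.mulVec v := by
  let := Matrix.linftyOpNormedRing (n := n) (α := ℂ)
  let := Matrix.linftyOpNormedAlgebra (n := n) (R := ℂ) (α := ℂ)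
  have : CompleteSpace (Matrix n n ℂ) := FiniteDimensional.complete ℂ _
  rcases isEmpty_or_nonempty n with hn | hn
  · rw [spectrum.SpectralRadius.of_subsingleton] at hρ
    simp at hρ
  obtain ⟨z, hz, hzr⟩ := spectrum.exists_nnnorm_eq_spectralRadius (M.map ((↑) : ℝ → ℂ))
  rw [← hzr] at hρ
  have hz1 : 1 ≤ ‖z‖ := by exact_mod_cast hρ
  rw [← Matrix.spectrum_toLin', ← Module.End.hasEigenvalue_iff_mem_spectrum] at hz
  obtain ⟨u, hu⟩ := hz.exists_hasEigenvector
  refine ⟨fun i => ‖u i‖, ?_, fun i => norm_nonneg _, fun i => ?_⟩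
  · intro h
    refine hu.2 (funext fun i => ?_)
    simpa using congrFun h i
  · have h := congrFun hu.apply_eq_smul i
    rw [Matrix.toLin'_apply] at h
    calc ‖u i‖ ≤ ‖z‖ * ‖u i‖ := le_mul_of_one_le_left (norm_nonneg _) hz1
      _ = ‖(M.map ((↑) : ℝ → ℂ)).mulVec u i‖ := by rw [h]; simp
      _ ≤ ∑ j, ‖(M i j : ℂ) * u j‖ := norm_sum_le _ _
      _ = M.mulVec (fun i => ‖u i‖) i := by
        simp [Matrix.mulVec, dotProduct, abs_of_nonneg (hM _ _)]

theorem tendsto_pow_apply_zero_of_spectralRadius_lt_one {M : Matrix n n ℝ}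
    (hρ : spectralRadius ℂ (M.map ((↑) : ℝ → ℂ)) < 1) (i j : n) :
    Filter.Tendsto (fun k : ℕ => (M ^ k) i j) Filter.atTop (nhds 0) := by
  let := Matrix.linftyOpNormedRing (n := n) (α := ℂ)
  let := Matrix.linftyOpNormedAlgebra (n := n) (R := ℂ) (α := ℂ)
  have : CompleteSpace (Matrix n n ℂ) := FiniteDimensional.complete ℂ _
  set Z : Matrix n n ℂ := M.map ((↑) : ℝ → ℂ) with hZ
  obtain ⟨r, hr, hr1⟩ := exists_between hρ
  have hle : ∀ᶠ k : ℕ in Filter.atTop, (‖Z ^ k‖₊ : ℝ≥0∞) ≤ r ^ k := by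
    filter_upwards [(spectrum.pow_nnnorm_pow_one_div_tendsto_nhds_spectralRadius Z).eventually_lt_const hr,
      Filter.eventually_gt_atTop 0] with k hk hk0
    have := ENNReal.rpow_le_rpow hk.le (z := (k : ℝ)) (by positivity)
    rwa [← ENNReal.rpow_mul, one_div, inv_mul_cancel₀ (by positivity), ENNReal.rpow_one,
      ENNReal.rpow_natCast] at this
  have hn : Filter.Tendsto (fun k : ℕ => (‖Z ^ k‖₊ : ℝ≥0∞)) Filter.atTop (nhds 0) :=
    tendsto_of_tendsto_of_tendsto_of_le_of_le' tendsto_const_nhds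
      (ENNReal.tendsto_pow_atTop_nhds_zero_of_lt_one hr1)
      (Filter.Eventually.of_forall fun _ => zero_le) hle
  have hn' : Filter.Tendsto (fun k : ℕ => Z ^ k) Filter.atTop (nhds 0) := by
    have h := NNReal.tendsto_coe.2 ((ENNReal.tendsto_coe (a := 0)).1 hn)
    exact tendsto_zero_iff_norm_tendsto_zero.2 h
  have he : Filter.Tendsto (fun k : ℕ => (Z ^ k) i j) Filter.atTop (nhds 0) :=
    ((continuous_id.matrix_elem i j).tendsto (0 : Matrix n n ℂ)).comp hn'
  have hpow : ∀ k, (Z ^ k) i j = ((M ^ k) i j : ℂ) := fun k => by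
    have : Z ^ k = (M ^ k).map ((↑) : ℝ → ℂ) :=
      (map_pow (Complex.ofRealHom.mapMatrix (m := n)) M k).symm
    rw [this, Matrix.map_apply]
  simp_rw [hpow] at he
  exact_mod_cast (Complex.continuous_re.tendsto 0).comp he

theorem tendsto_pow_mulVec_zero_of_spectralRadius_lt_one {M : Matrix n n ℝ}
    (hρ : spectralRadius ℂ (M.map ((↑) : ℝ → ℂ)) < 1) (v : n → ℝ) (i : n) :
    Filter.Tendsto (fun k : ℕ => (M ^ k).mulVec v i) Filter.atTop (nhds 0) := by
  simp only [Matrix.mulVec, dotProduct]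
  have := tendsto_finsetSum Finset.univ fun j (_ : j ∈ Finset.univ) =>
    (tendsto_pow_apply_zero_of_spectralRadius_lt_one hρ i j).mul_const (v j)
  simpa using this

theorem subharmonic_nonpos_of_spectralRadius_lt_one {M : Matrix n n ℝ} (hM : ∀ i j, 0 ≤ M i j)
    (hρ : spectralRadius ℂ (M.map ((↑) : ℝ → ℂ)) < 1) {v : n → ℝ} (hv : v ≤ M.mulVec v) :
    v ≤ 0 := by
  have iter : ∀ k : ℕ, v ≤ (M ^ k).mulVec v := by
    intro k
    induction k with
    | zero => simp
    | succ k ih =>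
      rw [pow_succ', ← Matrix.mulVec_mulVec]
      exact hv.trans fun i => Finset.sum_le_sum fun j _ => mul_le_mul_of_nonneg_left (ih j) (hM i j)
  exact fun i => ge_of_tendsto' (tendsto_pow_mulVec_zero_of_spectralRadius_lt_one hρ v i)
    fun k => iter k i

end

/-! ### Closed pairs as words -/

/-- The times visited by path `b` of the pair coded by the word `w`: the start `0`, the common end
`w.length + 1`, and `j + 1` for each position `j` carrying the letter `some b`. -/
def traceSet (w : List (Option Bool)) (b : Bool) : Set ℕ :=
  {k | k = 0 ∨ k = w.length + 1 ∨ ∃ j, k = j + 1 ∧ w[j]? = some (some b)}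

theorem le_of_mem_traceSet {w : List (Option Bool)} {b : Bool} {k : ℕ} (hk : k ∈ traceSet w b) :
    k ≤ w.length + 1 := by
  rcases hk with rfl | rfl | ⟨j, rfl, hj⟩
  · omega
  · omega
  · have := (List.getElem?_eq_some_iff.1 hj).1
    omega

theorem succ_mem_traceSet_iff {w : List (Option Bool)} {b : Bool} {j : ℕ} (hj : j < w.length) :
    j + 1 ∈ traceSet w b ↔ w[j]? = some (some b) := by
  simp [traceSet, hj.ne]

theorem traceSet_injective {w w' : List (Option Bool)}
    (h : ∀ b, traceSet w b = traceSet w' b) : w = w' := by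
  have hlen : w.length = w'.length := by
    have h₁ : w.length + 1 ∈ traceSet w' true := h true ▸ Or.inr (Or.inl rfl)
    have h₂ : w'.length + 1 ∈ traceSet w true := h true ▸ Or.inr (Or.inl rfl)
    have h₁ := le_of_mem_traceSet h₁
    have h₂ := le_of_mem_traceSet h₂
    omega
  refine List.ext_getElem hlen fun j hj hj' => ?_
  have key : ∀ b, w[j] = some b ↔ w'[j] = some b := fun b => by
    have := (succ_mem_traceSet_iff (b := b) hj).symm.trans
      ((Set.ext_iff.1 (h b) (j + 1)).trans (succ_mem_traceSet_iff hj'))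
    simpa [hj, hj'] using this
  exact Option.ext key

theorem idxOf_eq_of_forall_lt {α : Type*} [BEq α] [LawfulBEq α] {l : List α} {x : α} {d : ℕ}
    (h : ∀ j < d, l[j]? ≠ some x) (hd : d = l.length ∨ l[d]? = some x) : l.idxOf x = d := by
  induction l generalizing d with
  | nil => simpa [eq_comm] using hd
  | cons y l ih =>
    rcases d with _ | d
    · simp at hd; simp [hd]
    · have h0 := h 0 (by omega)
      have hne : (y == x) = false := by simpa using h0
      rw [List.idxOf_cons, hne,
        ih (fun j hj => by simpa using h (j + 1) (Nat.succ_lt_succ hj)) (by simpa using hd)]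
      rfl

namespace IncSeq

theorem ext_of_range {s t : IncSeq} (h : Set.range s.term = Set.range t.term) : s = t := by
  obtain ⟨n, f, f0, hf⟩ := s
  obtain ⟨m, g, g0, hg⟩ := t
  have hnm : n = m := by
    have h₁ := Nat.card_range_of_injective hf.injective
    have h₂ := Nat.card_range_of_injective hg.injective
    have h : Set.range f = Set.range g := h
    rw [h, h₂] at h₁
    simpa using h₁.symm
  subst hnm
  obtain rfl : f = g := (StrictMono.range_inj hf hg).1 h
  rfl

theorem exists_range_eq {S : Set ℕ} (hS : S.Finite) (h0 : 0 ∈ S) :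
    ∃ t : IncSeq, Set.range t.term = S := by
  lift S to Finset ℕ using hS
  have hpos : 0 < S.card := Finset.card_pos.2 ⟨0, h0⟩
  have hc : S.card = S.card - 1 + 1 := by omega
  refine ⟨⟨S.card - 1, S.orderEmbOfFin hc, ?_, (S.orderEmbOfFin hc).strictMono⟩,
    Finset.range_orderEmbOfFin S hc⟩
  have := Finset.orderEmbOfFin_zero hc (Nat.succ_pos _)
  exact this.trans (Nat.le_zero.1 (Finset.min'_le S 0 h0))

theorem zero_mem_range (t : IncSeq) : 0 ∈ Set.range t.term := ⟨0, t.term_zero⟩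

theorem le_last (t : IncSeq) (i : Fin (t.n + 1)) : t.term i ≤ t.term (Fin.last t.n) :=
  t.strictMono.monotone (Fin.le_last i)

section

variable {t : IncSeq} {w : List (Option Bool)} {b : Bool}

theorem term_last_eq (h : Set.range t.term = traceSet w b) :
    t.term (Fin.last t.n) = w.length + 1 := by
  apply le_antisymm
  · exact le_of_mem_traceSet (h ▸ Set.mem_range_self _)
  · obtain ⟨i, hi⟩ : w.length + 1 ∈ Set.range t.term := h ▸ Or.inr (Or.inl rfl)
    exact hi ▸ t.le_last i

theorem n_pos (h : Set.range t.term = traceSet w b) : 0 < t.n := by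
  have := term_last_eq h
  by_contra hn
  have h0 : Fin.last t.n = 0 := Fin.ext (by simp; omega)
  rw [h0, t.term_zero] at this
  omega

theorem jump_eq (h : Set.range t.term = traceSet w b) (i : Fin t.n) :
    t.jump i = Nat.succPNat ((w.drop (t.term i.castSucc)).idxOf (some b)) := by
  have huv : t.term i.castSucc < t.term i.succ := t.strictMono i.castSucc_lt_succ
  have hgap : ∀ k, t.term i.castSucc < k → k < t.term i.succ → k ∉ traceSet w b := by
    rintro k h₁ h₂ hk
    obtain ⟨m, rfl⟩ := h ▸ hk
    have h₁ := t.strictMono.lt_iff_lt.1 h₁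
    have h₂ := t.strictMono.lt_iff_lt.1 h₂
    simp only [Fin.lt_def, Fin.val_castSucc, Fin.val_succ] at h₁ h₂
    omega
  have hv : t.term i.succ ∈ traceSet w b := h ▸ Set.mem_range_self _
  have hvl := le_of_mem_traceSet hv
  have : (w.drop (t.term i.castSucc)).idxOf (some b)
      = t.term i.succ - t.term i.castSucc - 1 := by
    refine idxOf_eq_of_forall_lt (fun j hj => ?_) ?_
    · rw [List.getElem?_drop]
      have := hgap (t.term i.castSucc + j + 1) (by omega) (by omega)
      rwa [succ_mem_traceSet_iff (by omega)] at this
    · rw [List.getElem?_drop, List.length_drop]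
      rcases hv with hv | hv | ⟨j, hj, hw⟩
      · omega
      · left; omega
      · right; rw [← hw]; congr 1; omega
  apply PNat.eq
  rw [Nat.succPNat_coe, this]
  change t.term i.succ - t.term i.castSucc = _
  omega

open Classical in
theorem pathCoeff_eq_prod_range {Ω : Type*} (A : ℤ → ℕ+ → Ω → ℝ)
    (h : Set.range t.term = traceSet w b) (ω : Ω) :
    pathCoeff A t ω = ∏ k ∈ Finset.range (w.length + 1),
      if k ∈ traceSet w b then A (-k) (Nat.succPNat ((w.drop k).idxOf (some b))) ω else 1 := by
  rw [← Finset.prod_filter]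
  have himg : (Finset.range (w.length + 1)).filter (· ∈ traceSet w b) =
      Finset.univ.image fun i : Fin t.n => t.term i.castSucc := by
    ext k
    simp only [Finset.mem_filter, Finset.mem_range, Finset.mem_image, Finset.mem_univ, true_and]
    rw [← h, ← term_last_eq h]
    constructor
    · rintro ⟨hk, m, rfl⟩
      have hm := t.strictMono.lt_iff_lt.1 hk
      exact ⟨m.castPred hm.ne, by simp⟩
    · rintro ⟨i, rfl⟩
      exact ⟨t.strictMono (Fin.castSucc_lt_last i), Set.mem_range_self _⟩
  rw [himg, Finset.prod_image]
  · exact Finset.prod_congr rfl fun i _ => by rw [tildeCoeff, jump_eq h]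
  · intro i _ j _ hij
    exact Fin.castSucc_injective _ (t.strictMono.injective hij)

end

end IncSeq

theorem traceSet_finite (w : List (Option Bool)) (b : Bool) : (traceSet w b).Finite :=
  (Set.finite_Iic (w.length + 1)).subset fun _ hk => le_of_mem_traceSet hk

/-- Path `b` of the pair coded by the word `w`. -/
noncomputable def traceSeq (w : List (Option Bool)) (b : Bool) : IncSeq :=
  (IncSeq.exists_range_eq (traceSet_finite w b) (Or.inl rfl)).choose

theorem range_traceSeq (w : List (Option Bool)) (b : Bool) :
    Set.range (traceSeq w b).term = traceSet w b :=
  (IncSeq.exists_range_eq (traceSet_finite w b) (Or.inl rfl)).choose_spec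

theorem traceSeq_mem_closedPairs (w : List (Option Bool)) :
    (traceSeq w true, traceSeq w false) ∈ closedPairs := by
  have ht := range_traceSeq w true
  have hf := range_traceSeq w false
  refine ⟨IncSeq.n_pos ht, IncSeq.n_pos hf,
    (IncSeq.term_last_eq ht).trans (IncSeq.term_last_eq hf).symm, ?_⟩
  dsimp only
  intro i j hi hil _ _ hij
  have h₀ : 0 < (traceSeq w true).term i := by
    have := (traceSeq w true).strictMono hi
    rwa [IncSeq.term_zero] at this
  have h₁ : (traceSeq w true).term i < w.length + 1 :=
    IncSeq.term_last_eq ht ▸ (traceSeq w true).strictMono hil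
  obtain ⟨k, hk⟩ := Nat.exists_eq_succ_of_ne_zero h₀.ne'
  have hkt : k + 1 ∈ traceSet w true := ht ▸ ⟨i, hk⟩
  have hkf : k + 1 ∈ traceSet w false := hf ▸ ⟨j, hij ▸ hk⟩
  rw [succ_mem_traceSet_iff (by omega)] at hkt hkf
  simp [hkt] at hkf

open Classical in
theorem exists_word_of_mem_closedPairs {s t : IncSeq} (hq : (s, t) ∈ closedPairs) :
    ∃ w, traceSeq w true = s ∧ traceSeq w false = t := by
  obtain ⟨hs, ht, hl, hne⟩ := hq
  dsimp only at hs ht hl hne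
  have hlpos : 0 < s.term (Fin.last s.n) := by
    have := s.strictMono (show (0 : Fin (s.n + 1)) < Fin.last s.n from Fin.lt_def.2 (by simpa))
    rwa [s.term_zero] at this
  let w : List (Option Bool) := (List.range (s.term (Fin.last s.n) - 1)).map fun k =>
    if k + 1 ∈ Set.range s.term then some true
    else if k + 1 ∈ Set.range t.term then some false else none
  have hlen : w.length + 1 = s.term (Fin.last s.n) := by simp [w]; omega
  have hget : ∀ j, j < w.length → w[j]? = some (if j + 1 ∈ Set.range s.term then some true
      else if j + 1 ∈ Set.range t.term then some false else none) := by
    intro j hj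
    have : j < s.term (Fin.last s.n) - 1 := by omega
    simp [w, this]
  have interior : ∀ (u : IncSeq), u.term (Fin.last u.n) = w.length + 1 → ∀ i j,
      j < w.length → u.term i = j + 1 → 0 < i ∧ i < Fin.last u.n := by
    intro u hu i j hj hi
    constructor
    · exact u.strictMono.lt_iff_lt.1 (by rw [u.term_zero]; omega)
    · exact u.strictMono.lt_iff_lt.1 (by omega)
  have hdisj : ∀ j, j < w.length → j + 1 ∈ Set.range s.term → j + 1 ∉ Set.range t.term := by
    rintro j hj ⟨i, hi⟩ ⟨i', hi'⟩
    have h₁ := interior s hlen.symm i j hj hi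
    have h₂ := interior t (by omega) i' j hj hi'
    exact hne i i' h₁.1 h₁.2 h₂.1 h₂.2 (hi.trans hi'.symm)
  have range_eq : ∀ (u : IncSeq) (b : Bool), u.term (Fin.last u.n) = w.length + 1 →
      (∀ j, j < w.length → (j + 1 ∈ Set.range u.term ↔ w[j]? = some (some b))) →
      Set.range u.term = traceSet w b := by
    intro u b hu hb
    ext k
    constructor
    · intro hk
      have hkl : k ≤ w.length + 1 := by
        obtain ⟨i, rfl⟩ := hk
        exact hu ▸ u.le_last i
      rcases k with _ | j
      · exact Or.inl rfl
      · rcases (Nat.lt_or_ge j w.length) with hj | hj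
        · exact Or.inr (Or.inr ⟨j, rfl, (hb j hj).1 hk⟩)
        · exact Or.inr (Or.inl (by omega))
    · rintro (rfl | rfl | ⟨j, rfl, hj⟩)
      · exact u.zero_mem_range
      · exact ⟨_, hu⟩
      · exact (hb j (List.getElem?_eq_some_iff.1 hj).1).2 hj
  refine ⟨w, IncSeq.ext_of_range ?_, IncSeq.ext_of_range ?_⟩
  · rw [range_traceSeq, range_eq s true hlen.symm]
    intro j hj
    rw [hget j hj]
    split_ifs with h₁ h₂ <;> simp [h₁]
  · rw [range_traceSeq, range_eq t false (by omega)]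
    intro j hj
    rw [hget j hj]
    split_ifs with h₁ h₂
    · simpa using hdisj j hj h₁
    · simp [h₂]
    · simp [h₂]

/-- Closed pairs correspond to words in three letters: an interior time belongs to the first
sequence, to the second, or to neither. -/
noncomputable def wordEquiv : List (Option Bool) ≃ closedPairs :=
  Equiv.ofBijective (fun w => ⟨(traceSeq w true, traceSeq w false), traceSeq_mem_closedPairs w⟩) <| by
    constructor
    · intro w w' h
      simp only [Subtype.mk.injEq, Prod.mk.injEq] at h
      refine traceSet_injective fun b => ?_
      rw [← range_traceSeq, ← range_traceSeq]
      cases b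
      · rw [h.2]
      · rw [h.1]
    · rintro ⟨⟨s, t⟩, hq⟩
      obtain ⟨w, rfl, rfl⟩ := exists_word_of_mem_closedPairs hq
      exact ⟨w, rfl⟩

/-! ### Expectations of path coefficients -/

theorem wordWeight_eq_prod (a : ℕ → ℝ≥0∞) (w : List (Option Bool)) :
    wordWeight a w = ∏ k ∈ Finset.range w.length,
      (if w[k]? = some (some true) then a ((w.drop (k + 1)).idxOf (some true)) else 1) *
      (if w[k]? = some (some false) then a ((w.drop (k + 1)).idxOf (some false)) else 1) := by
  induction w with
  | nil => simp [wordWeight]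
  | cons x w ih =>
    rw [List.length_cons, Finset.prod_range_succ']
    simp only [List.getElem?_cons_succ, List.drop_succ_cons, List.drop_zero,
      List.getElem?_cons_zero]
    rw [← ih]
    rcases x with _ | _ | _ <;> simp [wordWeight, mul_comm]

section

variable {Ω : Type*} [MeasurableSpace Ω]

/-- `E[A_{k+1}]`: the weight of a jump of length `k + 1`, indexed from `0`. -/
noncomputable def coeffMean (μ : Measure Ω) (A : ℤ → ℕ+ → Ω → ℝ) (k : ℕ) : ℝ≥0∞ :=
  ∫⁻ ω, ENNReal.ofReal (A 1 (Nat.succPNat k) ω) ∂μ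

/-- `E[A_{k+1} A_{l+1}]`: the joint weight of simultaneous jumps of lengths `k + 1` and `l + 1`. -/
noncomputable def coeffMoment (μ : Measure Ω) (A : ℤ → ℕ+ → Ω → ℝ) (k l : ℕ) : ℝ≥0∞ :=
  ∫⁻ ω, ENNReal.ofReal (A 1 (Nat.succPNat k) ω * A 1 (Nat.succPNat l) ω) ∂μ

open Classical in
/-- The two paths of a closed pair use the coefficients of a common time only at time `0`, so by
independence the expectation factors over the times. -/
theorem lintegral_pathCoeff_traceSeq {μ : Measure Ω} [IsProbabilityMeasure μ]
    {A : ℤ → ℕ+ → Ω → ℝ} (hA_meas : ∀ t j, Measurable (A t j))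
    (hA_nonneg : ∀ t j, ∀ᵐ ω ∂μ, 0 ≤ A t j ω)
    (h_indep : iIndepFun (fun (t : ℤ) (ω : Ω) (j : ℕ+) => A t j ω) μ)
    (h_ident : ∀ t : ℤ, IdentDistrib (fun ω (j : ℕ+) => A t j ω) (fun ω (j : ℕ+) => A 1 j ω) μ μ)
    (w : List (Option Bool)) :
    ∫⁻ ω, ENNReal.ofReal
        (pathCoeff A (traceSeq w true) ω * pathCoeff A (traceSeq w false) ω) ∂μ =
      coeffMoment μ A (w.idxOf (some true)) (w.idxOf (some false)) *
        wordWeight (coeffMean μ A) w := by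
  let G : ℕ → (ℕ+ → ℝ) → ℝ := fun k x =>
    (if k ∈ traceSet w true then x (Nat.succPNat ((w.drop k).idxOf (some true))) else 1) *
    (if k ∈ traceSet w false then x (Nat.succPNat ((w.drop k).idxOf (some false))) else 1)
  have hG : ∀ k, Measurable fun x => ENNReal.ofReal (G k x) := by
    intro k
    refine ENNReal.measurable_ofReal.comp (Measurable.mul ?_ ?_) <;>
    · split_ifs
      · exact measurable_pi_apply _
      · exact measurable_const
  have hV : ∀ t, Measurable fun ω (j : ℕ+) => A t j ω := fun t =>
    measurable_pi_lambda _ fun j => hA_meas t j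
  have hind : iIndepFun (fun (k : ℕ) (ω : Ω) =>
      ENNReal.ofReal (G k fun j => A (-(k : ℤ)) j ω)) μ :=
    (h_indep.precomp (g := fun k : ℕ => -(k : ℤ))
      (neg_injective.comp Nat.cast_injective)).comp _ hG
  have hid : ∀ k : ℕ, ∫⁻ ω, ENNReal.ofReal (G k fun j => A (-(k : ℤ)) j ω) ∂μ =
      ∫⁻ ω, ENNReal.ofReal (G k fun j => A 1 j ω) ∂μ := fun k =>
    ((h_ident (-k)).comp (hG k)).lintegral_eq
  have hnn : ∀ᵐ ω ∂μ, ∀ t j, 0 ≤ A t j ω :=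
    ae_all_iff.2 fun t => ae_all_iff.2 fun j => hA_nonneg t j
  have hprod : ∀ᵐ ω ∂μ, ENNReal.ofReal
      (pathCoeff A (traceSeq w true) ω * pathCoeff A (traceSeq w false) ω) =
      ∏ k ∈ Finset.range (w.length + 1), ENNReal.ofReal (G k fun j => A (-(k : ℤ)) j ω) := by
    filter_upwards [hnn] with ω hω
    rw [IncSeq.pathCoeff_eq_prod_range A (range_traceSeq w true),
      IncSeq.pathCoeff_eq_prod_range A (range_traceSeq w false), ← Finset.prod_mul_distrib,
      ENNReal.ofReal_prod_of_nonneg]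
    intro k _
    refine mul_nonneg ?_ ?_ <;>
    · split_ifs
      · exact hω _ _
      · exact zero_le_one
  rw [lintegral_congr_ae hprod, lintegral_prod_eq_prod_lintegral_of_indepFun _ _ hind
    (fun k => (hG k).comp (hV _)), Finset.prod_congr rfl fun k _ => hid k,
    Finset.prod_range_succ', mul_comm, wordWeight_eq_prod]
  congr 1
  · have h0 : ∀ b, 0 ∈ traceSet w b := fun b => Or.inl rfl
    simp [G, h0, coeffMoment]
  · refine Finset.prod_congr rfl fun k hk => ?_
    have hk := Finset.mem_range.1 hk
    simp only [G, succ_mem_traceSet_iff hk]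
    rcases w[k]? with _ | _ | _ | _ <;> simp [coeffMean]

theorem tsum_closedPairs_eq {μ : Measure Ω} [IsProbabilityMeasure μ]
    {A : ℤ → ℕ+ → Ω → ℝ} (hA_meas : ∀ t j, Measurable (A t j))
    (hA_nonneg : ∀ t j, ∀ᵐ ω ∂μ, 0 ≤ A t j ω)
    (h_indep : iIndepFun (fun (t : ℤ) (ω : Ω) (j : ℕ+) => A t j ω) μ)
    (h_ident : ∀ t : ℤ, IdentDistrib (fun ω (j : ℕ+) => A t j ω) (fun ω (j : ℕ+) => A 1 j ω) μ μ) :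
    ∑' q : closedPairs,
        ∫⁻ ω, ENNReal.ofReal (pathCoeff A q.1.1 ω * pathCoeff A q.1.2 ω) ∂μ =
      ∑' k, ∑' l, coeffMoment μ A k l * hitWeight (coeffMean μ A) ⊤ k l := by
  rw [← tsum_mul_wordWeight, ← wordEquiv.tsum_eq]
  exact tsum_congr fun w =>
    lintegral_pathCoeff_traceSeq hA_meas hA_nonneg h_indep h_ident w

theorem tsum_coeffMean (μ : Measure Ω) (A : ℤ → ℕ+ → Ω → ℝ) :
    ∑' k, coeffMean μ A k = ∑' j : ℕ+, ∫⁻ ω, ENNReal.ofReal (A 1 j ω) ∂μ :=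
  Equiv.pnatEquivNat.symm.tsum_eq fun j : ℕ+ => ∫⁻ ω, ENNReal.ofReal (A 1 j ω) ∂μ

/-- A Jensen inequality: if `S` dominates `g gᵀ` as a quadratic form, then `E[X S Xᵀ]` dominates
`(E[X] g) (E[X] g)ᵀ`. -/
theorem sq_le_quadraticForm_mean_kronecker {μ : Measure Ω} [IsProbabilityMeasure μ]
    {ι : Type*} [Fintype ι] {X : Ω → Matrix ι ι ℝ}
    (hX : ∀ i k, MemLp (fun ω => X ω i k) 2 μ) {S : ι × ι → ℝ} {g : ι → ℝ}
    (hS : ∀ x : ι → ℝ, (x ⬝ᵥ g) ^ 2 ≤ ∑ i, ∑ j, x i * x j * S (i, j)) (x : ι → ℝ) :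
    (x ⬝ᵥ (Matrix.of fun i k => ∫ ω, X ω i k ∂μ).mulVec g) ^ 2 ≤
      ∑ i, ∑ j, x i * x j *
        (Matrix.of fun u v => ∫ ω, (X ω ⊗ₖ X ω) u v ∂μ).mulVec S (i, j) := by
  have hXi : ∀ i k, Integrable (fun ω => X ω i k) μ := fun i k => (hX i k).integrable one_le_two
  have hXX : ∀ i j k l, Integrable (fun ω => X ω i k * X ω j l) μ := fun i j k l =>
    (hX i k).integrable_mul (hX j l)
  -- `f = xᵀ X g` and `q = xᵀ (X S Xᵀ) x`.
  let f : Ω → ℝ := fun ω => ∑ i, x i * ∑ k, X ω i k * g k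
  let q : Ω → ℝ := fun ω => ∑ i, ∑ j, x i * x j * ∑ k, ∑ l, X ω i k * X ω j l * S (k, l)
  have hf : MemLp f 2 μ :=
    memLp_finsetSum _ fun i _ => (memLp_finsetSum _ fun k _ => (hX i k).mul_const _).const_mul _
  have hq : Integrable q μ :=
    integrable_finsetSum _ fun i _ => integrable_finsetSum _ fun j _ => Integrable.const_mul
      (integrable_finsetSum _ fun k _ => integrable_finsetSum _ fun l _ =>
        (hXX i j k l).mul_const _) _
  have hfq : ∀ ω, f ω ^ 2 ≤ q ω := by
    intro ω
    refine le_of_eq_of_le ?_ ((hS fun k => ∑ i, x i * X ω i k).trans_eq ?_)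
    · congr 1
      simp only [f, dotProduct, Finset.mul_sum, Finset.sum_mul]
      rw [Finset.sum_comm]
      simp only [mul_assoc]
    · simp only [q, Finset.mul_sum, Finset.sum_mul]
      have e₁ : ∀ F : ι → ι → ι → ι → ℝ, ∑ k, ∑ l, ∑ i, ∑ j, F k l i j
          = ∑ i, ∑ j, ∑ k, ∑ l, F k l i j := by
        intro F
        simp_rw [← Fintype.sum_prod_type' (f := fun i j => F _ _ i j)]
        simp_rw [← Fintype.sum_prod_type' (f := fun k l => ∑ y : ι × ι, F k l y.1 y.2)]
        rw [Finset.sum_comm]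
        simp_rw [Fintype.sum_prod_type]
      refine Eq.trans ?_ (e₁ _)
      refine Finset.sum_congr rfl fun k _ => Finset.sum_congr rfl fun l _ => ?_
      rw [Finset.sum_comm]
      refine Finset.sum_congr rfl fun i _ => Finset.sum_congr rfl fun j _ => ?_
      ring
  have hfint : ∫ ω, f ω ∂μ = x ⬝ᵥ (Matrix.of fun i k => ∫ ω, X ω i k ∂μ).mulVec g := by
    simp only [f, dotProduct, Matrix.mulVec, Matrix.of_apply]
    rw [integral_finsetSum _ fun i _ => Integrable.const_mul
      (integrable_finsetSum _ fun k _ => (hXi i k).mul_const _) _]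
    refine Finset.sum_congr rfl fun i _ => ?_
    rw [integral_const_mul, integral_finsetSum _ fun k _ => (hXi i k).mul_const _]
    simp_rw [integral_mul_const]
  have hqint : ∫ ω, q ω ∂μ = ∑ i, ∑ j, x i * x j *
      (Matrix.of fun u v => ∫ ω, (X ω ⊗ₖ X ω) u v ∂μ).mulVec S (i, j) := by
    have hkl : ∀ i j, Integrable (fun ω => ∑ k, ∑ l, X ω i k * X ω j l * S (k, l)) μ :=
      fun i j => integrable_finsetSum _ fun k _ => integrable_finsetSum _ fun l _ =>
        (hXX i j k l).mul_const _
    simp only [q, dotProduct, Matrix.mulVec, Matrix.of_apply, Matrix.kroneckerMap_apply,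
      Fintype.sum_prod_type]
    rw [integral_finsetSum _ fun i _ => integrable_finsetSum _ fun j _ => (hkl i j).const_mul _]
    refine Finset.sum_congr rfl fun i _ => ?_
    rw [integral_finsetSum _ fun j _ => (hkl i j).const_mul _]
    refine Finset.sum_congr rfl fun j _ => ?_
    rw [integral_const_mul, integral_finsetSum _ fun k _ => integrable_finsetSum _ fun l _ =>
        (hXX i j k l).mul_const _]
    congr 1
    refine Finset.sum_congr rfl fun k _ => ?_
    rw [integral_finsetSum _ fun l _ => (hXX i j k l).mul_const _]
    simp_rw [integral_mul_const]
  calc _ = (∫ ω, f ω ∂μ) ^ 2 := by rw [hfint]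
    _ ≤ ∫ ω, f ω ^ 2 ∂μ := by
      have := variance_nonneg f μ
      rw [variance_eq_sub hf] at this
      simpa using this
    _ ≤ ∫ ω, q ω ∂μ := integral_mono hf.integrable_sq hq hfq
    _ = _ := hqint

end

/-! ### The companion matrix and its mean tensor square -/

theorem tsum_eq_sum_fin {p : ℕ} {f : ℕ → ℝ≥0∞} (hf : ∀ k, p ≤ k → f k = 0) :
    ∑' k, f k = ∑ k : Fin p, f k := by
  rw [tsum_eq_sum (s := Finset.range p) fun k hk => hf k (by simpa using hk), Finset.sum_range]

section

variable {Ω : Type*} [MeasurableSpace Ω] {μ : Measure Ω} {A : ℤ → ℕ+ → Ω → ℝ} {p : ℕ}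

theorem coeffMean_eq_zero (h_order : ∀ (t : ℤ) (j : ℕ+), p < (j : ℕ) → ∀ᵐ ω ∂μ, A t j ω = 0)
    {k : ℕ} (hk : p ≤ k) : coeffMean μ A k = 0 := by
  rw [coeffMean, lintegral_congr_ae (g := fun _ => 0), lintegral_zero]
  filter_upwards [h_order 1 (Nat.succPNat k) (by simpa using Nat.lt_succ_of_le hk)] with ω hω
  simp [hω]

theorem coeffMoment_eq_zero (h_order : ∀ (t : ℤ) (j : ℕ+), p < (j : ℕ) → ∀ᵐ ω ∂μ, A t j ω = 0)
    {k l : ℕ} (h : p ≤ k ∨ p ≤ l) : coeffMoment μ A k l = 0 := by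
  rw [coeffMoment, lintegral_congr_ae (g := fun _ => 0), lintegral_zero]
  rcases h with h | h
  · filter_upwards [h_order 1 (Nat.succPNat k) (by simpa using Nat.lt_succ_of_le h)] with ω hω
    simp [hω]
  · filter_upwards [h_order 1 (Nat.succPNat l) (by simpa using Nat.lt_succ_of_le h)] with ω hω
    simp [hω]

theorem measurable_companionMatrix (hA_meas : ∀ t j, Measurable (A t j)) (i k : Fin p) :
    Measurable fun ω => companionMatrix A p 1 ω i k := by
  simp only [companionMatrix, Matrix.of_apply]
  split_ifs
  · exact hA_meas _ _
  · exact measurable_const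
  · exact measurable_const

theorem companionMatrix_nonneg (hA_nonneg : ∀ t j, ∀ᵐ ω ∂μ, 0 ≤ A t j ω) :
    ∀ᵐ ω ∂μ, ∀ i k, 0 ≤ companionMatrix A p 1 ω i k := by
  filter_upwards [ae_all_iff.2 fun j => hA_nonneg 1 j] with ω hω i k
  simp only [companionMatrix, Matrix.of_apply]
  split_ifs
  · exact hω _
  · exact zero_le_one
  · exact le_rfl

theorem memLp_companionMatrix (hA_meas : ∀ t j, Measurable (A t j))
    (hint : ∀ i j, Integrable (fun ω => companionSq A p ω i j) μ) (i k : Fin p) :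
    MemLp (fun ω => companionMatrix A p 1 ω i k) 2 μ := by
  rw [memLp_two_iff_integrable_sq (measurable_companionMatrix hA_meas i k).aestronglyMeasurable]
  simpa [companionSq, sq] using hint (i, i) (k, k)

theorem integrable_companionSq [IsFiniteMeasure μ] (hA_meas : ∀ t j, Measurable (A t j))
    (hfin : ∀ k, coeffMoment μ A k k ≠ ∞)
    (u v : Fin p × Fin p) : Integrable (fun ω => companionSq A p ω u v) μ := by
  have hA : ∀ k, MemLp (A 1 (Nat.succPNat k)) 2 μ := by
    intro k
    rw [memLp_two_iff_integrable_sq (hA_meas 1 _).aestronglyMeasurable,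
      ← lintegral_ofReal_ne_top_iff_integrable ((hA_meas 1 _).pow_const 2).aestronglyMeasurable
        (Filter.Eventually.of_forall fun _ => sq_nonneg _)]
    simpa only [sq, coeffMoment] using hfin k
  have hC : ∀ i k, MemLp (fun ω => companionMatrix A p 1 ω i k) 2 μ := by
    intro i k
    simp only [companionMatrix, Matrix.of_apply]
    split_ifs
    · exact hA k
    · exact memLp_const 1
    · exact memLp_const 0
  exact (hC u.1 v.1).integrable_mul (hC u.2 v.2)

/-- The entrywise expectation `E[𝐀 ⊗ 𝐀]` as a real matrix; its complexification is
`meanCompanionSq`. -/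
noncomputable def realMeanCompanionSq (μ : Measure Ω) (A : ℤ → ℕ+ → Ω → ℝ) (p : ℕ) :
    Matrix (Fin p × Fin p) (Fin p × Fin p) ℝ :=
  Matrix.of fun u v => ∫ ω, companionSq A p ω u v ∂μ

theorem meanCompanionSq_eq_map :
    meanCompanionSq μ A p = (realMeanCompanionSq μ A p).map ((↑) : ℝ → ℂ) := rfl

theorem companionSq_nonneg (hA_nonneg : ∀ t j, ∀ᵐ ω ∂μ, 0 ≤ A t j ω) (u v : Fin p × Fin p) :
    ∀ᵐ ω ∂μ, 0 ≤ companionSq A p ω u v := by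
  filter_upwards [companionMatrix_nonneg (p := p) hA_nonneg] with ω hω
  exact mul_nonneg (hω _ _) (hω _ _)

theorem realMeanCompanionSq_nonneg (hA_nonneg : ∀ t j, ∀ᵐ ω ∂μ, 0 ≤ A t j ω)
    (u v : Fin p × Fin p) : 0 ≤ realMeanCompanionSq μ A p u v :=
  integral_nonneg_of_ae (companionSq_nonneg hA_nonneg u v)

/-- A companion matrix only moves mass along paths: row `0` makes a jump, row `i + 1` steps down to
`i`. Hence `E[𝐀 ⊗ 𝐀]` acts on the states below `p` as `secondMomentStep` does on all states. -/
theorem ofReal_realMeanCompanionSq_mulVec [IsProbabilityMeasure μ]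
    (hA_nonneg : ∀ t j, ∀ᵐ ω ∂μ, 0 ≤ A t j ω)
    (h_order : ∀ (t : ℤ) (j : ℕ+), p < (j : ℕ) → ∀ᵐ ω ∂μ, A t j ω = 0)
    (hint : ∀ i j, Integrable (fun ω => companionSq A p ω i j) μ)
    {v : Fin p × Fin p → ℝ} (hv : 0 ≤ v) {f : ℕ → ℕ → ℝ≥0∞}
    (hf : ∀ i j : Fin p, f i j = ENNReal.ofReal (v (i, j))) (i j : Fin p) :
    ENNReal.ofReal ((realMeanCompanionSq μ A p).mulVec v (i, j)) =
      secondMomentStep (coeffMean μ A) (coeffMoment μ A) f i j := by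
  have h₁ : ENNReal.ofReal ((realMeanCompanionSq μ A p).mulVec v (i, j)) =
      ∑ k : Fin p, ∑ l : Fin p, (∫⁻ ω, ENNReal.ofReal
        (companionMatrix A p 1 ω i k * companionMatrix A p 1 ω j l) ∂μ) * f k l := by
    rw [Matrix.mulVec, dotProduct, ENNReal.ofReal_sum_of_nonneg fun u _ =>
      mul_nonneg (realMeanCompanionSq_nonneg hA_nonneg _ u) (hv u), Fintype.sum_prod_type]
    refine Finset.sum_congr rfl fun k _ => Finset.sum_congr rfl fun l _ => ?_
    rw [ENNReal.ofReal_mul (realMeanCompanionSq_nonneg hA_nonneg _ _), hf]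
    congr 1
    exact ofReal_integral_eq_lintegral_ofReal (hint (i, j) (k, l))
      (companionSq_nonneg hA_nonneg (i, j) (k, l))
  rw [h₁]
  have top : ∀ (ω : Ω) (h : 0 < p) (k : Fin p),
      companionMatrix A p 1 ω ⟨0, h⟩ k = A 1 (Nat.succPNat k) ω := fun ω h k => by
    simp [companionMatrix]
  have shift : ∀ (ω : Ω) (i : ℕ) (h : i + 1 < p) (k : Fin p),
      companionMatrix A p 1 ω ⟨i + 1, h⟩ k = if k = ⟨i, by omega⟩ then 1 else 0 :=
    fun ω i h k => by simp [companionMatrix, Fin.ext_iff, eq_comm]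
  obtain ⟨i, hi⟩ := i
  obtain ⟨j, hj⟩ := j
  rcases i with _ | i <;> rcases j with _ | j
  · simp only [top, secondMomentStep]
    rw [tsum_eq_sum_fin (p := p) fun k hk => by
      simp [coeffMoment_eq_zero h_order (Or.inl hk)]]
    refine Finset.sum_congr rfl fun k _ => ?_
    rw [tsum_eq_sum_fin (p := p) fun l hl => by
      simp [coeffMoment_eq_zero h_order (Or.inr hl)]]
    rfl
  · simp only [top, shift, secondMomentStep]
    rw [tsum_eq_sum_fin (p := p) fun k hk => by simp [coeffMean_eq_zero h_order hk]]
    refine Finset.sum_congr rfl fun k _ => ?_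
    rw [Finset.sum_eq_single ⟨j, by omega⟩ (fun l _ hl => by simp [hl]) (by simp)]
    simp [coeffMean]
  · simp only [top, shift, secondMomentStep]
    rw [tsum_eq_sum_fin (p := p) fun k hk => by simp [coeffMean_eq_zero h_order hk]]
    rw [Finset.sum_eq_single ⟨i, by omega⟩ (fun l _ hl => by simp [hl]) (by simp)]
    refine Finset.sum_congr rfl fun k _ => ?_
    simp [coeffMean]
  · simp only [shift, secondMomentStep]
    rw [Finset.sum_eq_single ⟨i, by omega⟩ (fun l _ hl => by simp [hl]) (by simp),
      Finset.sum_eq_single ⟨j, by omega⟩ (fun l _ hl => by simp [hl]) (by simp)]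
    simp

/-- If `∑ E[A_k] ≥ 1`, every row sum of `E[𝐀]` is at least `1`, so vectors bounded below by `1`
are preserved. -/
theorem one_le_mean_companionMatrix_mulVec [IsProbabilityMeasure μ]
    (hA_meas : ∀ t j, Measurable (A t j)) (hA_nonneg : ∀ t j, ∀ᵐ ω ∂μ, 0 ≤ A t j ω)
    (h_order : ∀ (t : ℤ) (j : ℕ+), p < (j : ℕ) → ∀ᵐ ω ∂μ, A t j ω = 0)
    (hint : ∀ i j, Integrable (fun ω => companionSq A p ω i j) μ)
    (ha : 1 ≤ ∑' k, coeffMean μ A k) {g : Fin p → ℝ} (hg : 1 ≤ g) :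
    1 ≤ (Matrix.of fun i k => ∫ ω, companionMatrix A p 1 ω i k ∂μ).mulVec g := by
  have hnn : ∀ i k, 0 ≤ ∫ ω, companionMatrix A p 1 ω i k ∂μ := fun i k =>
    integral_nonneg_of_ae ((companionMatrix_nonneg hA_nonneg).mono fun ω hω => hω i k)
  intro i
  have hrow : ∑ k, ∫ ω, companionMatrix A p 1 ω i k ∂μ ≤
      (Matrix.of fun i k => ∫ ω, companionMatrix A p 1 ω i k ∂μ).mulVec g i :=
    Finset.sum_le_sum fun k _ => le_mul_of_one_le_right (hnn i k) (hg k)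
  refine le_trans ?_ hrow
  change (1 : ℝ) ≤ _
  obtain ⟨i, hi⟩ := i
  rcases i with _ | i
  · rw [← ENNReal.one_le_ofReal, ENNReal.ofReal_sum_of_nonneg fun k _ => hnn _ k]
    rw [tsum_eq_sum_fin (p := p) fun k hk => coeffMean_eq_zero h_order hk] at ha
    refine ha.trans_eq (Finset.sum_congr rfl fun k _ => ?_)
    rw [ofReal_integral_eq_lintegral_ofReal
      ((memLp_companionMatrix hA_meas hint _ k).integrable one_le_two)
      ((companionMatrix_nonneg hA_nonneg).mono fun ω hω => hω _ k)]
    simp [coeffMean, companionMatrix]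
  · refine le_trans ?_ (Finset.single_le_sum (f := fun k =>
      ∫ ω, companionMatrix A p 1 ω ⟨i + 1, hi⟩ k ∂μ) (fun k _ => hnn _ k)
      (Finset.mem_univ ⟨i, by omega⟩))
    simp [companionMatrix]

/-- If `∑ E[A_k] ≥ 1`, the powers of `M = E[𝐀 ⊗ 𝐀]` do not tend to zero: with `S₀ = 𝟙𝟙ᵀ`, the
second moments `Sₙ = Mⁿ S₀` dominate `gₙgₙᵀ` as quadratic forms, where `gₙ = E[𝐀]ⁿ 𝟙 ≥ 𝟙`. An
entrywise comparison of `E[𝐀 ⊗ 𝐀]` with `E[𝐀] ⊗ E[𝐀]` is not available, since the coefficients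
may be negatively correlated. -/
theorem tsum_coeffMean_lt_one [IsProbabilityMeasure μ]
    (hA_meas : ∀ t j, Measurable (A t j)) (hA_nonneg : ∀ t j, ∀ᵐ ω ∂μ, 0 ≤ A t j ω)
    (h_order : ∀ (t : ℤ) (j : ℕ+), p < (j : ℕ) → ∀ᵐ ω ∂μ, A t j ω = 0)
    (hint : ∀ i j, Integrable (fun ω => companionSq A p ω i j) μ)
    (hρ : spectralRadius ℂ (meanCompanionSq μ A p) < 1) : ∑' k, coeffMean μ A k < 1 := by
  by_contra! ha
  have hp : 0 < p := by
    by_contra hp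
    rw [tsum_eq_sum_fin (p := p) fun k hk => coeffMean_eq_zero h_order hk] at ha
    obtain rfl : p = 0 := by omega
    simp at ha
  have key : ∀ n : ℕ, ∃ g : Fin p → ℝ, 1 ≤ g ∧ ∀ x : Fin p → ℝ, (x ⬝ᵥ g) ^ 2 ≤
      ∑ i, ∑ j, x i * x j * ((realMeanCompanionSq μ A p) ^ n).mulVec 1 (i, j) := by
    intro n
    induction n with
    | zero =>
      refine ⟨1, le_rfl, fun x => le_of_eq ?_⟩
      simp [dotProduct, sq, Finset.sum_mul_sum]
    | succ n ih =>
      obtain ⟨g, hg, hgx⟩ := ih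
      refine ⟨_, one_le_mean_companionMatrix_mulVec hA_meas hA_nonneg h_order hint ha hg,
        fun x => ?_⟩
      rw [pow_succ' (realMeanCompanionSq μ A p), ← Matrix.mulVec_mulVec]
      exact sq_le_quadraticForm_mean_kronecker (memLp_companionMatrix hA_meas hint) hgx x
  have hone : ∀ n : ℕ, 1 ≤ ((realMeanCompanionSq μ A p) ^ n).mulVec 1 (⟨0, hp⟩, ⟨0, hp⟩) := by
    intro n
    obtain ⟨g, hg, hgx⟩ := key n
    have := hgx (Pi.single ⟨0, hp⟩ 1)
    simp [Pi.single_apply] at this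
    have h1 := hg ⟨0, hp⟩
    simp only [Pi.one_apply] at h1
    nlinarith
  rw [meanCompanionSq_eq_map] at hρ
  have := ge_of_tendsto' (tendsto_pow_mulVec_zero_of_spectralRadius_lt_one hρ 1 _) hone
  norm_num at this

end

theorem theorem3 {Ω : Type*} [MeasurableSpace Ω] (μ : Measure Ω) [IsProbabilityMeasure μ]
    (A : ℤ → ℕ+ → Ω → ℝ) (B : ℤ → Ω → ℝ)
    (hA_meas : ∀ t j, Measurable (A t j)) (hB_meas : ∀ t, Measurable (B t))
    (hA_nonneg : ∀ t j, ∀ᵐ ω ∂μ, 0 ≤ A t j ω) (hB_nonneg : ∀ t, ∀ᵐ ω ∂μ, 0 ≤ B t ω)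
    -- the vectors `((A_{t,j})_{j ≥ 1}, B_t)` are independent and identically distributed
    (h_indep : iIndepFun (fun (t : ℤ) (ω : Ω) => ((fun j : ℕ+ => A t j ω), B t ω)) μ)
    (h_ident : ∀ t : ℤ, IdentDistrib (fun ω => ((fun j : ℕ+ => A t j ω), B t ω))
      (fun ω => ((fun j : ℕ+ => A 1 j ω), B 1 ω)) μ μ)
    -- finite order `p`
    (p : ℕ) (h_order : ∀ (t : ℤ) (j : ℕ+), p < (j : ℕ) → ∀ᵐ ω ∂μ, A t j ω = 0)
    -- positive coefficients
    (h_pos : ∀ (t : ℤ) (j : ℕ+), (j : ℕ) ≤ p → ∀ᵐ ω ∂μ, 0 < A t j ω)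
    -- `B` is independent of `(A_1, …, A_p)` and square integrable
    (h_indepB : IndepFun (B 1) (fun ω => fun j : Fin p => A 1 (Nat.succPNat j) ω) μ)
    (h_sqB : MemLp (B 1) 2 μ) :
    ((∑' q : closedPairs,
        ∫⁻ ω, ENNReal.ofReal (pathCoeff A q.1.1 ω * pathCoeff A q.1.2 ω) ∂μ) < 1 ∧
      (∑' j : ℕ+, ∫⁻ ω, ENNReal.ofReal (A 1 j ω) ∂μ) < 1) ↔
    ((∀ i j, Integrable (fun ω => companionSq A p ω i j) μ) ∧
      spectralRadius ℂ (meanCompanionSq μ A p) < 1) := by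
  have h_indepA : iIndepFun (fun (t : ℤ) (ω : Ω) (j : ℕ+) => A t j ω) μ :=
    h_indep.comp (fun _ => Prod.fst) fun _ => measurable_fst
  have h_identA : ∀ t : ℤ, IdentDistrib (fun ω (j : ℕ+) => A t j ω)
      (fun ω (j : ℕ+) => A 1 j ω) μ μ := fun t => (h_ident t).comp measurable_fst
  rw [tsum_closedPairs_eq hA_meas hA_nonneg h_indepA h_identA, ← tsum_coeffMean]
  constructor
  · rintro ⟨hF, ha⟩
    have hfin : ∀ k, coeffMoment μ A k k ≠ ∞ := by
      intro k
      have : coeffMoment μ A k k * hitWeight (coeffMean μ A) ⊤ k k < 1 :=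
        ((ENNReal.le_tsum k).trans (ENNReal.le_tsum k)).trans_lt hF
      rw [hitWeight_diag, mul_one] at this
      exact this.ne_top
    have hint := integrable_companionSq (p := p) hA_meas hfin
    refine ⟨hint, ?_⟩
    by_contra! hρ
    rw [meanCompanionSq_eq_map] at hρ
    obtain ⟨v, hv0, hvnn, hv⟩ := exists_subharmonic_of_one_le_spectralRadius
      (realMeanCompanionSq_nonneg hA_nonneg) hρ
    -- Extended by zero, the eigenvector moduli stay subharmonic on all of `ℕ × ℕ`.
    let f : ℕ → ℕ → ℝ≥0∞ := fun i j =>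
      if h : i < p ∧ j < p then ENNReal.ofReal (v (⟨i, h.1⟩, ⟨j, h.2⟩)) else 0
    have hf : ∀ i j : Fin p, f i j = ENNReal.ofReal (v (i, j)) := fun i j => by simp [f]
    refine hv0 (funext fun u => le_antisymm ?_ (hvnn u))
    have h0 := eq_zero_of_le_secondMomentStep (v := f)
      (C := ∑ u, ENNReal.ofReal (v u)) ha hF (by simp [ENNReal.sum_eq_top]) ?_ ?_ u.1 u.2
    · rw [hf] at h0
      exact ENNReal.ofReal_eq_zero.1 h0
    · intro i j
      by_cases h : i < p ∧ j < p
      · simp only [f, dif_pos h]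
        exact Finset.single_le_sum (f := fun u => ENNReal.ofReal (v u)) (fun _ _ => zero_le)
          (Finset.mem_univ ((⟨i, h.1⟩, ⟨j, h.2⟩) : Fin p × Fin p))
      · simp [f, dif_neg h]
    · intro i j
      by_cases h : i < p ∧ j < p
      · have := ofReal_realMeanCompanionSq_mulVec hA_nonneg h_order hint hvnn hf
          ⟨i, h.1⟩ ⟨j, h.2⟩
        rw [← this]
        exact (hf ⟨i, h.1⟩ ⟨j, h.2⟩).trans_le (ENNReal.ofReal_le_ofReal (hv _))
      · simp [f, dif_neg h]
  · rintro ⟨hint, hρ⟩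
    have ha := tsum_coeffMean_lt_one hA_meas hA_nonneg h_order hint hρ
    refine ⟨?_, ha⟩
    by_contra! hF
    have hp : 0 < p := by
      by_contra hp
      have hz : ∀ k l, coeffMoment μ A k l = 0 := fun k l =>
        coeffMoment_eq_zero h_order (Or.inl (by omega))
      simp [hz] at hF
    -- The hitting weights, finite by `hitWeight_top_le_one`, are a nonzero subharmonic vector.
    have hle := hitWeight_top_le_one ha.le
    have hsub := hitWeight_le_secondMomentStep hF
    let v : Fin p × Fin p → ℝ := fun u => (hitWeight (coeffMean μ A) ⊤ u.1 u.2).toReal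
    have hvnn : 0 ≤ v := fun u => ENNReal.toReal_nonneg
    have hv : ∀ i j : Fin p, hitWeight (coeffMean μ A) ⊤ i j = ENNReal.ofReal (v (i, j)) :=
      fun i j => (ENNReal.ofReal_toReal ((hle i j).trans_lt ENNReal.one_lt_top).ne).symm
    have hM := realMeanCompanionSq_nonneg (μ := μ) (A := A) (p := p) hA_nonneg
    have hvM : v ≤ (realMeanCompanionSq μ A p).mulVec v := by
      intro u
      have hnn : 0 ≤ (realMeanCompanionSq μ A p).mulVec v u :=
        Finset.sum_nonneg fun w _ => mul_nonneg (hM u w) (hvnn w)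
      rw [← ENNReal.ofReal_le_ofReal_iff hnn,
        ofReal_realMeanCompanionSq_mulVec hA_nonneg h_order hint hvnn hv u.1 u.2, ← hv]
      exact hsub _ _
    rw [meanCompanionSq_eq_map] at hρ
    have h0 := subharmonic_nonpos_of_spectralRadius_lt_one hM hρ hvM (⟨0, hp⟩, ⟨0, hp⟩)
    have h1 : v (⟨0, hp⟩, ⟨0, hp⟩) = 1 := by
      simp [v, hitWeight_diag]
    rw [h1] at h0
    simp at h0
    linarith
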